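/- Let $p$ be a prime and let $|\cdot|_p$ be the $p$-adic absolute value, extended to $\overline{\mathbb{Q}}_p$. **Notation.** For a letter $a$ let $A_a=\begin{pmatrix}0&1\\1&a\end{pmatrix}$; for a finite word $u=a_1\cdots a_n$ let $A_u=A_{a_1}\cdots A_{a_n}$ (the identity for the empty word). For an infinite word $w=a_1a_2\cdots$ let $w_n$ be its prefix of length $n$, let $\mathrm{T}$ be the left shift, and for $\mathbf{q}\in\mathbf{P}^1_{\mathbb{Q}_p}$ put $\mathrm{T}(w,\mathbf{q})=(\mathrm{T}w,A_{a_1}\mathbf{q})$. For $\epsilon>0$, $\mathbf{PBad}_\epsilon$ is the set of $(q_1:q_2)\in\mathbf{P}^1_{\mathbb{Q}_p}$ such that $$|aq_1+bq_2|_p\cdot\min\{|q_1|_p^{-1},|q_2|_p^{-1}\}\ \ge\ \epsilon\cdot\min\{|a|^{-2},|b|^{-2}\}\qquad\text{for all }(a,b)\in\mathbb{Z}^2\setminus\{(0,0)\}$$ (with $|0|^{-1}=\infty$), and $\mathbf{LMad}$ is the set of pairs $(w,\mathbf{x}_p)$ for which there is $\epsilon>0$ such that $\mathrm{T}^n(w,\mathbf{x}_p)\in\{1,\dots,N\}^{\mathbb{N}}\times\mathbf{PBad}_\epsilon$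 for all $n\ge 0$, where $N=\lfloor\epsilon^{-1}\rfloor+1$. Let $V(n,w)=\{A_{w_m}: m\ge 0,\ w_n\text{ is a prefix of }\mathrm{T}^mw\}$, and let $V_p(w)=\bigcap_{n\ge1}\overline{V(n,w)}$, the closures being taken in the $2\times2$ matrices over $\mathbb{Z}_p$. Let $\widetilde{\mathrm{SL}}_2(\mathbb{Z}_p)$ be the set of $2\times 2$ matrices $A$ over $\mathbb{Z}_p$ with $\det A=\pm1$ that have two different eigenvectors in $\mathbf{P}^1_{\overline{\mathbb{Q}}_p}$ and satisfy $\log(\lambda^{\kappa(A)})\ne0$ for each eigenvalue $\lambda$. Here $\log x=\sum_{n\ge1}(-1)^{n-1}(x-1)^n/n$ is the $p$-adic logarithm, and $\kappa(A)$ is the least positive integer $k$ with $|\lambda^{k}-1|_p\le p^{-1}$ for each eigenvalue $\lambda$ of $A$. **Theorem.** Let $w$ be an infinite word and let $A\in\widetilde{\mathrm{SL}}_2(\mathbb{Z}_p)$ be an element of $V_p(w)$. Then $A^T$ has exactly two eigenvectors $\mathbf{w}_1\neq\mathbf{w}_2$ in $\mathbf{P}^1_{\overline{\mathbb{Q}}_p}$,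 and $(w,\mathbf{x}_p)\in\mathbf{LMad}$ is possible only for $\mathbf{x}_p=\mathbf{w}_1$ or $\mathbf{x}_p=\mathbf{w}_2$. In particular there are at most two points $\mathbf{x}_p\in\mathbf{P}^1_{\mathbb{Q}_p}$ with $(w,\mathbf{x}_p)\in\mathbf{LMad}$. Any such $\mathbf{x}_p$ has the form $(\xi:1)$ with $\xi\in\mathbb{Q}_p\setminus\mathbb{Q}$ algebraic of degree at most $2$ over the field generated over $\mathbb{Q}$ by the entries of $A$; if the entries of $A$ are rational, then $\xi$ is a quadratic irrational, that is, algebraic of degree exactly $2$ over $\mathbb{Q}$. -/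

import Mathlib

namespace PadicLittlewood

/-- The matrix `A_a = (0 1; 1 a)` attached to a letter `a`. -/
def letterMat (a : ℕ) : Matrix (Fin 2) (Fin 2) ℤ := !![0, 1; 1, a]

/-- The matrix `A_u = A_{a₁} ⋯ A_{aₙ}` of a finite word `u = a₁ … aₙ`; it is the identity for the
empty word. -/
def wordMat (u : List ℕ) : Matrix (Fin 2) (Fin 2) ℤ := (u.map letterMat).prod

/-- The prefix `w_n` of length `n` of an infinite word `w = w 0, w 1, …`. -/
def wordPrefix (w : ℕ → ℕ) (n : ℕ) : List ℕ := (List.range n).map w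

/-- The left shift on infinite words, iterated `m` times. -/
def shift (m : ℕ) (w : ℕ → ℕ) : ℕ → ℕ := fun i => w (m + i)

/-- The alphabet `{1, …, N}`; `wordsOver N` is the set of infinite words over it. -/
def wordsOver (N : ℕ) : Set (ℕ → ℕ) := {w | ∀ i, 1 ≤ w i ∧ w i ≤ N}

/-- A point of the projective line is an eigenvector of `M`. -/
def IsEigenpoint {K : Type*} [Field K] (M : Matrix (Fin 2) (Fin 2) K)
    (v : Projectivization K (Fin 2 → K)) : Prop :=
  ∃ μ : K, M.mulVec v.rep = μ • v.rep

theorem isEigenpoint_mk {K : Type*} [Field K] (M : Matrix (Fin 2) (Fin 2) K)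
    (v : Fin 2 → K) (hv : v ≠ 0) :
    IsEigenpoint M (Projectivization.mk K v hv) ↔ ∃ μ : K, M.mulVec v = μ • v := by
  obtain ⟨a, ha⟩ := Projectivization.exists_smul_eq_mk_rep K v hv
  unfold IsEigenpoint
  rw [← ha]
  refine exists_congr fun μ => ?_
  rw [Matrix.mulVec_smul, smul_comm μ a v]
  exact smul_left_cancel_iff a

section

variable (p : ℕ) [Fact p.Prime]

theorem letterMat_injective (a : ℕ) :
    Function.Injective (((letterMat a).map (Int.cast : ℤ → ℚ_[p])).mulVecLin) := by
  rw [Matrix.coe_mulVecLin]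
  apply Matrix.mulVec_injective_of_isUnit
  rw [Matrix.isUnit_iff_isUnit_det]
  simp [letterMat, Matrix.det_fin_two]

/-- The action of `A_a` on the projective line over `ℚ_p`. -/
noncomputable def letterAct (a : ℕ) :
    Projectivization ℚ_[p] (Fin 2 → ℚ_[p]) → Projectivization ℚ_[p] (Fin 2 → ℚ_[p]) :=
  Projectivization.map ((letterMat a).map (Int.cast : ℤ → ℚ_[p])).mulVecLin
    (letterMat_injective p a)

/-- The extension `T (w, q) = (T w, A_{a₁} q)`, with `a₁` the first letter of `w`, of the left shift
to pairs. -/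
noncomputable def shiftPair (x : (ℕ → ℕ) × Projectivization ℚ_[p] (Fin 2 → ℚ_[p])) :
    (ℕ → ℕ) × Projectivization ℚ_[p] (Fin 2 → ℚ_[p]) :=
  (shift 1 x.1, letterAct p (x.1 0) x.2)

/-- The points `(q₁ : q₂)` of the projective line over `ℚ_p` with
`|a q₁ + b q₂| · min (|q₁|⁻¹, |q₂|⁻¹) ≥ ε · min (|a|⁻², |b|⁻²)` for all integers `(a, b) ≠ (0, 0)`,
where `|0|⁻¹ = ∞`; the denominators are cleared. The condition does not depend on the choice of
homogeneous coordinates, see `mk_mem_PBadEps`. -/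
def PBadEps (ε : ℝ) : Set (Projectivization ℚ_[p] (Fin 2 → ℚ_[p])) :=
  {q | ∀ a b : ℤ, (a, b) ≠ (0, 0) →
    ε * max ‖q.rep 0‖ ‖q.rep 1‖ ≤
      ‖(a : ℚ_[p]) * q.rep 0 + (b : ℚ_[p]) * q.rep 1‖ * max |(a : ℝ)| |(b : ℝ)| ^ 2}

theorem mk_mem_PBadEps (ε : ℝ) (v : Fin 2 → ℚ_[p]) (hv : v ≠ 0) :
    Projectivization.mk ℚ_[p] v hv ∈ PBadEps p ε ↔ ∀ a b : ℤ, (a, b) ≠ (0, 0) →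
      ε * max ‖v 0‖ ‖v 1‖ ≤
        ‖(a : ℚ_[p]) * v 0 + (b : ℚ_[p]) * v 1‖ * max |(a : ℝ)| |(b : ℝ)| ^ 2 := by
  obtain ⟨c, hc⟩ := Projectivization.exists_smul_eq_mk_rep ℚ_[p] v hv
  have hc0 : 0 < ‖(c : ℚ_[p])‖ := norm_pos_iff.mpr c.ne_zero
  unfold PBadEps
  rw [Set.mem_ofPred_eq, ← hc]
  refine forall_congr' fun a => forall_congr' fun b => imp_congr_right fun _ => ?_
  have h1 : (a : ℚ_[p]) * (c • v) 0 + (b : ℚ_[p]) * (c • v) 1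
      = (c : ℚ_[p]) * ((a : ℚ_[p]) * v 0 + (b : ℚ_[p]) * v 1) := by
    simp only [Pi.smul_apply, Units.smul_def, smul_eq_mul]; ring
  have h2 : max ‖(c • v) 0‖ ‖(c • v) 1‖ = ‖(c : ℚ_[p])‖ * max ‖v 0‖ ‖v 1‖ := by
    simp only [Pi.smul_apply, Units.smul_def, smul_eq_mul, norm_mul]
    rw [mul_max_of_nonneg _ _ hc0.le]
  rw [h1, h2, norm_mul, mul_left_comm, mul_assoc, mul_le_mul_iff_right₀ hc0]

/-- The pairs `(w, x)` all of whose iterates under `T` lie in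
`{1, …, N}^ℕ × PBadEps`, where `N = ⌊ε⁻¹⌋ + 1`. -/
def LMadEps (ε : ℝ) : Set ((ℕ → ℕ) × Projectivization ℚ_[p] (Fin 2 → ℚ_[p])) :=
  {x | ∀ n : ℕ, ((shiftPair p)^[n] x).1 ∈ wordsOver (⌊ε⁻¹⌋₊ + 1) ∧
    ((shiftPair p)^[n] x).2 ∈ PBadEps p ε}

/-- The set `LMad`, the union of the sets `LMadEps` over all `ε > 0`. -/
def LMad : Set ((ℕ → ℕ) × Projectivization ℚ_[p] (Fin 2 → ℚ_[p])) :=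
  {x | ∃ ε : ℝ, 0 < ε ∧ x ∈ LMadEps p ε}

/-- `V(n, w)`: the matrices `A_{w_m}`, `m ≥ 0`, such that `w_n` is a prefix of `T^m w`. -/
def V (n : ℕ) (w : ℕ → ℕ) : Set (Matrix (Fin 2) (Fin 2) ℤ) :=
  {M | ∃ m : ℕ, wordPrefix (shift m w) n = wordPrefix w n ∧ M = wordMat (wordPrefix w m)}

/-- `V(n, w)`, considered as a set of matrices over `ℤ_p`. -/
def VpLevel (n : ℕ) (w : ℕ → ℕ) : Set (Matrix (Fin 2) (Fin 2) ℤ_[p]) :=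
  (fun M : Matrix (Fin 2) (Fin 2) ℤ => M.map (Int.cast : ℤ → ℤ_[p])) '' V n w

/-- `V_p(w)`: the intersection over `n ≥ 1` of the closures of `V(n, w)` in the `p`-adic
topology. -/
def Vp (w : ℕ → ℕ) : Set (Matrix (Fin 2) (Fin 2) ℤ_[p]) :=
  ⋂ n ∈ Set.Ici 1, closure (VpLevel p n w)

/-- A matrix over `ℤ_p`, considered over the algebraic closure of `ℚ_p`. -/
noncomputable def toAlgCl (A : Matrix (Fin 2) (Fin 2) ℤ_[p]) :
    Matrix (Fin 2) (Fin 2) (PadicAlgCl p) :=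
  A.map fun z => algebraMap ℚ_[p] (PadicAlgCl p) (z : ℚ_[p])

/-- `SL₂^±(ℤ_p)`: the matrices of determinant `±1`. -/
def SLpm : Set (Matrix (Fin 2) (Fin 2) ℤ_[p]) := {A | A.det = 1 ∨ A.det = -1}

/-- `SL^±_{2,1}(ℤ_p)`: the matrices in `SL₂^±(ℤ_p)` with two different eigenvectors in the
projective line over the algebraic closure of `ℚ_p`. -/
def SLpmOne : Set (Matrix (Fin 2) (Fin 2) ℤ_[p]) :=
  {A | A ∈ SLpm p ∧ ∃ v₁ v₂ : Projectivization (PadicAlgCl p) (Fin 2 → PadicAlgCl p),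
    v₁ ≠ v₂ ∧ IsEigenpoint (toAlgCl p A) v₁ ∧ IsEigenpoint (toAlgCl p A) v₂}

/-- The `p`-adic logarithm `log x = ∑_{n ≥ 1} (-1)^(n-1) (x - 1)^n / n`. The series converges for
`‖x - 1‖ < 1`, as it takes place in the complete field `ℚ_p(x)`. The index is shifted by one. -/
noncomputable def padicLog (x : PadicAlgCl p) : PadicAlgCl p :=
  ∑' n : ℕ, (-1) ^ n * (x - 1) ^ (n + 1) / ((n + 1 : ℕ) : PadicAlgCl p)

/-- `κ(A)`: the least positive integer `k` with `‖λ^k - 1‖ ≤ p⁻¹` for each eigenvalue `λ` of `A`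
(for `A ∈ SL^±_{2,1}(ℤ_p)` there is one). -/
noncomputable def kappa (A : Matrix (Fin 2) (Fin 2) ℤ_[p]) : ℕ :=
  sInf {k : ℕ | 0 < k ∧ ∀ μ : PadicAlgCl p,
    Module.End.HasEigenvalue (Matrix.toLin' (toAlgCl p A)) μ → ‖μ ^ k - 1‖ ≤ (p : ℝ)⁻¹}

/-- The matrices `A ∈ SL^±_{2,1}(ℤ_p)` such that `log (λ^κ(A)) ≠ 0` for each eigenvalue `λ`. -/
def SLtilde : Set (Matrix (Fin 2) (Fin 2) ℤ_[p]) :=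
  {A | A ∈ SLpmOne p ∧ ∀ μ : PadicAlgCl p,
    Module.End.HasEigenvalue (Matrix.toLin' (toAlgCl p A)) μ → padicLog p (μ ^ kappa p A) ≠ 0}

/-- Coordinatewise inclusion of `ℚ_p²` into the plane over the algebraic closure of `ℚ_p`. -/
noncomputable def planeToAlgCl :
    (Fin 2 → ℚ_[p]) →ₛₗ[algebraMap ℚ_[p] (PadicAlgCl p)] (Fin 2 → PadicAlgCl p) where
  toFun v := fun i => algebraMap ℚ_[p] (PadicAlgCl p) (v i)
  map_add' u v := by ext i; simp
  map_smul' c v := by ext i; simp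

theorem planeToAlgCl_injective : Function.Injective (planeToAlgCl p) := by
  intro u v h
  ext i
  exact (algebraMap ℚ_[p] (PadicAlgCl p)).injective (congrFun h i)

/-- The inclusion of the projective line over `ℚ_p` into the one over the algebraic closure. -/
noncomputable def pointToAlgCl (x : Projectivization ℚ_[p] (Fin 2 → ℚ_[p])) :
    Projectivization (PadicAlgCl p) (Fin 2 → PadicAlgCl p) :=
  Projectivization.map (planeToAlgCl p) (planeToAlgCl_injective p) x

/-- The affine coordinate `ξ = x₁ / x₂` of a point `(x₁ : x₂)` (meaningful if `x₂ ≠ 0`). -/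
noncomputable def affineCoord (x : Projectivization ℚ_[p] (Fin 2 → ℚ_[p])) : ℚ_[p] :=
  x.rep 0 / x.rep 1

/-- The subfield of `ℚ_p` generated by the entries of `A`. -/
noncomputable def entryField (A : Matrix (Fin 2) (Fin 2) ℤ_[p]) : IntermediateField ℚ ℚ_[p] :=
  IntermediateField.adjoin ℚ {z : ℚ_[p] | ∃ i j, z = (A i j : ℚ_[p])}

end

end PadicLittlewood

open PadicLittlewood

/-!
The set `V_p(w)` is a closed monoid, and its elements, transposed, map `x` into a fixed closed cone
of badly approximable vectors as soon as `(w, x)` lies in `LMad`. Let `A` be in `V_p(w)`. Some power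
of `Aᵀ` is `1 + p² E`, and all `(1 + p² E) ^ t • x` lie in the cone. Suppose that `x` is not an
eigenvector of `E`. Then a nonzero integral linear form `ℓ` can be chosen so close to one that
annihilates `x` that `t ↦ ℓ ((1 + p² E) ^ t • x)` is, up to scaling, an isometry for the `p`-adic
metric from `ℕ` to a ball around `0` in `ℚ_p`. Its image is dense, so that `ℓ` takes arbitrarily
small values on the orbit of `x`, all of whose members have the norm of `x`; this contradicts
membership in the cone. Hence `x` is an eigenvector of a power of `Aᵀ`. This power is not scalar,
since otherwise the eigenvalues of `A` would be roots of unity and their logarithms would vanish, so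
`x` is an eigenvector of `Aᵀ` itself.
-/

namespace PadicLittlewood

open Filter Topology

section Logarithm

theorem sum_choose_mul_pow_div {K : Type*} [Field K] [CharZero K] (x : K) (m : ℕ) :
    ∑ k ∈ Finset.range (m + 1), (m.choose k : K) * x ^ (k + 1) / ((k + 1 : ℕ) : K)
      = ((1 + x) ^ (m + 1) - 1) / ((m + 1 : ℕ) : K) := by
  have hm : ((m + 1 : ℕ) : K) ≠ 0 := Nat.cast_ne_zero.mpr m.succ_ne_zero
  rw [eq_div_iff hm, Finset.sum_mul, add_comm 1 x, add_pow, Finset.sum_range_succ' _ (m + 1)]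
  simp only [one_pow, mul_one, pow_zero, Nat.choose_zero_right, Nat.cast_one, add_sub_cancel_right]
  refine Finset.sum_congr rfl fun k _ => ?_
  have hk : ((k + 1 : ℕ) : K) ≠ 0 := Nat.cast_ne_zero.mpr k.succ_ne_zero
  have h : ((m + 1 : ℕ) : K) * (m.choose k : K) =
      ((m + 1).choose (k + 1) : K) * ((k + 1 : ℕ) : K) := by
    exact_mod_cast Nat.add_one_mul_choose_eq m k
  rw [div_mul_eq_mul_div, div_eq_iff hk]
  linear_combination x ^ (k + 1) * h

variable {p : ℕ} [Fact p.Prime] {ι : Type*} {l : Filter ι} {m : ι → ℕ}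

theorem tendsto_choose_sub_one (hm₀ : ∀ i, m i ≠ 0)
    (hm : Tendsto (fun i => (m i : ℤ_[p])) l (𝓝 0)) (k : ℕ) :
    Tendsto (fun i => ((m i - 1).choose k : ℤ_[p])) l (𝓝 ((-1) ^ k)) := by
  have h_choose : Ring.choose (-1 : ℤ_[p]) k = (-1) ^ k := by
    rw [Ring.choose_neg', Ring.multichoose_one]
    simp [Int.negOnePow_def, Units.smul_def]
  have h_lim : Tendsto (fun i => (m i : ℤ_[p]) - 1) l (𝓝 (-1)) := by
    simpa using hm.sub_const 1
  rw [← h_choose]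
  refine (((PadicInt.continuous_choose k).tendsto (-1)).comp h_lim).congr fun i => ?_
  rw [← Ring.choose_natCast, Nat.cast_pred (Nat.pos_of_ne_zero (hm₀ i)), Function.comp_apply]

theorem norm_natCast_inv_le {k : ℕ} (hk : k ≠ 0) : ‖(k : ℚ_[p])‖⁻¹ ≤ k := by
  rw [Padic.norm_eq_zpow_neg_valuation (Nat.cast_ne_zero.mpr hk), Padic.valuation_natCast,
    zpow_neg, inv_inv, zpow_natCast]
  exact_mod_cast Nat.le_of_dvd (Nat.pos_of_ne_zero hk) pow_padicValNat_dvd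

theorem tendsto_pow_sub_one_div {K : Type*} [NormedField K] [NormedAlgebra ℚ_[p] K]
    [CompleteSpace K] {x : K} (hx : ‖x - 1‖ < 1) (hm₀ : ∀ i, m i ≠ 0)
    (hm : Tendsto (fun i => (m i : ℤ_[p])) l (𝓝 0)) :
    Tendsto (fun i => (x ^ m i - 1) / (m i : K)) l
      (𝓝 (∑' k : ℕ, (-1) ^ k * (x - 1) ^ (k + 1) / ((k + 1 : ℕ) : K))) := by
  have : CharZero K := charZero_of_injective_algebraMap (algebraMap ℚ_[p] K).injective
  have norm_natCast (k : ℕ) : ‖(k : K)‖ = ‖(k : ℚ_[p])‖ := by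
    rw [← map_natCast (algebraMap ℚ_[p] K) k, norm_algebraMap']
  let term (i : ι) (k : ℕ) : K := ((m i - 1).choose k : K) * (x - 1) ^ (k + 1) / ((k + 1 : ℕ) : K)
  have tsum_term (i : ι) : ∑' k, term i k = (x ^ m i - 1) / (m i : K) := by
    rw [tsum_eq_sum (s := Finset.range (m i - 1 + 1)), sum_choose_mul_pow_div, add_sub_cancel,
      Nat.sub_add_cancel (Nat.pos_of_ne_zero (hm₀ i))]
    intro k hk
    have h_lt : m i - 1 < k := by simpa using hk
    simp [term, Nat.choose_eq_zero_of_lt h_lt]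
  have tendsto_term (k : ℕ) : Tendsto (term · k) l
      (𝓝 ((-1) ^ k * (x - 1) ^ (k + 1) / ((k + 1 : ℕ) : K))) := by
    have h_coe : Continuous fun z : ℤ_[p] => algebraMap ℚ_[p] K z :=
      (continuous_algebraMap ℚ_[p] K).comp continuous_subtype_val
    have h_choose : Tendsto (fun i => ((m i - 1).choose k : K)) l (𝓝 ((-1) ^ k)) := by
      simpa [Function.comp_def] using (h_coe.tendsto _).comp (tendsto_choose_sub_one hm₀ hm k)
    exact (h_choose.mul_const _).div_const _
  have norm_term_le (i : ι) (k : ℕ) : ‖term i k‖ ≤ ((k + 1 : ℕ) : ℝ) * ‖x - 1‖ ^ (k + 1) := by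
    have h_choose : ‖((m i - 1).choose k : K)‖ ≤ 1 := by
      rw [norm_natCast]
      exact_mod_cast Padic.norm_int_le_one (p := p) _
    calc ‖term i k‖
        = ‖((k + 1 : ℕ) : ℚ_[p])‖⁻¹ * (‖((m i - 1).choose k : K)‖ * ‖x - 1‖ ^ (k + 1)) := by
          rw [norm_div, norm_mul, norm_pow, norm_natCast (k + 1), div_eq_inv_mul]
      _ ≤ ((k + 1 : ℕ) : ℝ) * (1 * ‖x - 1‖ ^ (k + 1)) := by
          gcongr
          exact norm_natCast_inv_le k.succ_ne_zero
      _ = ((k + 1 : ℕ) : ℝ) * ‖x - 1‖ ^ (k + 1) := by rw [one_mul]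
  have summable_bound : Summable fun k : ℕ => ((k + 1 : ℕ) : ℝ) * ‖x - 1‖ ^ (k + 1) := by
    have h_geom := summable_pow_mul_geometric_of_norm_lt_one (r := ‖x - 1‖) 1 (by rwa [norm_norm])
    simpa using (summable_nat_add_iff 1).mpr h_geom
  exact (tendsto_tsum_of_dominated_convergence summable_bound tendsto_term
    (Eventually.of_forall norm_term_le)).congr tsum_term

theorem padicLog_eq_zero_of_pow_eq_one {μ : PadicAlgCl p} (hμ : ‖μ - 1‖ < 1) {n : ℕ} (hn : n ≠ 0)
    (hμn : μ ^ n = 1) : padicLog p μ = 0 := by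
  unfold padicLog
  by_cases h_summable : Summable fun k : ℕ =>
      (-1) ^ k * (μ - 1) ^ (k + 1) / ((k + 1 : ℕ) : PadicAlgCl p)
  case neg => exact tsum_eq_zero_of_not_summable h_summable
  -- `PadicAlgCl p` is not complete, hence the passage to `ℂ_[p]`
  let φ := algebraMap (PadicAlgCl p) ℂ_[p]
  have hφ : ‖φ μ - 1‖ < 1 := by rwa [← map_one φ, ← map_sub, norm_algebraMap']
  have h_pow (r : ℕ) : φ μ ^ (p ^ r * n) = 1 := by
    rw [mul_comm, pow_mul, ← map_pow, hμn, map_one, one_pow]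
  have h_exp : Tendsto (fun r => ((p ^ r * n : ℕ) : ℤ_[p])) atTop (𝓝 0) := by
    have h_p : ‖(p : ℤ_[p])‖ < 1 := (PadicInt.norm_int_lt_one_iff_dvd p).mpr dvd_rfl
    simpa using (tendsto_pow_atTop_nhds_zero_of_norm_lt_one h_p).mul_const (n : ℤ_[p])
  have h_lim := tendsto_pow_sub_one_div hφ
    (fun r => mul_ne_zero (pow_ne_zero r (Fact.out : p.Prime).ne_zero) hn) h_exp
  simp only [h_pow, sub_self, zero_div] at h_lim
  apply φ.injective
  rw [map_zero, ← tendsto_nhds_unique h_lim tendsto_const_nhds,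
    h_summable.map_tsum φ (continuous_algebraMap _ _)]
  simp [φ]

end Logarithm

open Matrix

section Powers

theorem exists_aeval_eq_smul_one_add_smul {R : Type*} [CommRing R] (M : Matrix (Fin 2) (Fin 2) R)
    (F : Polynomial R) : ∃ a b : R, Polynomial.aeval M F = a • 1 + b • M := by
  nontriviality R
  have h_deg : (F %ₘ M.charpoly).degree < 2 := by
    simpa [charpoly_degree_eq_dim] using Polynomial.degree_modByMonic_lt F M.charpoly_monic
  refine ⟨(F %ₘ M.charpoly).coeff 0, (F %ₘ M.charpoly).coeff 1, ?_⟩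
  rw [aeval_eq_aeval_mod_charpoly,
    Polynomial.eq_X_add_C_of_degree_le_one (Order.le_of_lt_succ h_deg)]
  simp [Algebra.algebraMap_eq_smul_one, add_comm]

variable {p : ℕ} [Fact p.Prime]

theorem natCast_prime_dvd_natCast {q : ℕ} (hq : q.Prime) : (q : ℤ_[p]) ∣ p := by
  rcases eq_or_ne q p with rfl | h_ne
  · exact dvd_rfl
  · have h_unit : IsUnit (q : ℤ_[p]) := by
      rw [PadicInt.isUnit_iff, PadicInt.norm_natCast_eq_one_iff]
      exact (Nat.coprime_primes Fact.out hq).mpr h_ne.symm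
    exact h_unit.dvd

/-- The factor `p ^ 2`, rather than `p`, makes this true for `p = 2` as well. -/
theorem exists_one_add_sq_mul_pow_eq {S : Type*} [CommRing S] [Algebra ℤ_[p] S] (x : S) (t : ℕ) :
    ∃ y : S, (1 + p ^ 2 * x) ^ t = 1 + t * p ^ 2 * x * (1 + p * y) := by
  induction t using induction_on_primes with
  | zero => exact ⟨0, by simp⟩
  | one => exact ⟨0, by simp⟩
  | prime_mul q t hq ih =>
    obtain ⟨y, hy⟩ := ih
    obtain ⟨c, hc⟩ : (q : S) ∣ p := by
      simpa using map_dvd (algebraMap ℤ_[p] S) (natCast_prime_dvd_natCast (p := p) hq)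
    obtain ⟨k, hk⟩ := Polynomial.powAddExpansion (1 : S) (t * p ^ 2 * x * (1 + p * y)) q
    refine ⟨y + (1 + p * y) ^ 2 * k * c * t * x, ?_⟩
    rw [mul_comm q t, pow_mul, hy, hk]
    push_cast
    linear_combination k * t ^ 2 * p ^ 3 * x ^ 2 * (1 + p * y) ^ 2 * hc

theorem exists_one_add_sq_mul_pow_sub_pow_eq {S : Type*} [CommRing S] [Algebra ℤ_[p] S] (x : S)
    (s t : ℕ) :
    ∃ y : S, (1 + p ^ 2 * x) ^ s - (1 + p ^ 2 * x) ^ t = (s - t) * p ^ 2 * (x + p * (x * y)) := by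
  wlog hts : t ≤ s
  · obtain ⟨y, hy⟩ := this (p := p) x t s (le_of_not_ge hts)
    exact ⟨y, by linear_combination -hy⟩
  obtain ⟨k, rfl⟩ := Nat.exists_eq_add_of_le hts
  obtain ⟨y, hy⟩ := exists_one_add_sq_mul_pow_eq (p := p) x k
  obtain ⟨z, hz⟩ := exists_one_add_sq_mul_pow_eq (p := p) x t
  refine ⟨y + t * p * x * (1 + p * z) * (1 + p * y), ?_⟩
  rw [pow_add, hy, hz]
  push_cast
  ring

theorem exists_one_add_sq_smul_pow_sub_pow_eq (E : Matrix (Fin 2) (Fin 2) ℤ_[p]) (s t : ℕ) :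
    ∃ a b : ℤ_[p], (1 + (p : ℤ_[p]) ^ 2 • E) ^ s - (1 + (p : ℤ_[p]) ^ 2 • E) ^ t =
      ((s - t) * (p : ℤ_[p]) ^ 2) • (E + (p : ℤ_[p]) • (a • 1 + b • E)) := by
  obtain ⟨F, hF⟩ := exists_one_add_sq_mul_pow_sub_pow_eq (p := p) (Polynomial.X (R := ℤ_[p])) s t
  obtain ⟨a, b, hab⟩ := exists_aeval_eq_smul_one_add_smul E (Polynomial.X * F)
  have h := congrArg (Polynomial.aeval E) hF
  simp only [map_sub, map_pow, map_add, map_mul, map_one, map_natCast, Polynomial.aeval_X]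
    at h hab
  refine ⟨a, b, ?_⟩
  rw [← hab]
  simp only [Algebra.smul_def, map_mul, map_sub, map_pow, map_natCast]
  exact h

end Powers

section Orbit

variable {p : ℕ} [Fact p.Prime] {n : Type*} [Fintype n] [DecidableEq n]

/-- The inclusion of the matrices over `ℤ_p` into those over `ℚ_p`. -/
noncomputable def toPadic : Matrix n n ℤ_[p] →+* Matrix n n ℚ_[p] :=
  (algebraMap ℤ_[p] ℚ_[p]).mapMatrix

theorem toPadic_smul (c : ℤ_[p]) (M : Matrix n n ℤ_[p]) :
    toPadic (c • M) = (c : ℚ_[p]) • toPadic M := by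
  ext i j
  simp [toPadic]

theorem continuous_toPadic : Continuous (toPadic : Matrix n n ℤ_[p] → Matrix n n ℚ_[p]) :=
  continuous_id.matrix_map continuous_subtype_val

theorem norm_toPadic_mulVec_le (M : Matrix n n ℤ_[p]) (v : n → ℚ_[p]) :
    ‖toPadic M *ᵥ v‖ ≤ ‖v‖ := by
  refine (pi_norm_le_iff_of_nonneg (norm_nonneg v)).mpr fun i => ?_
  refine IsUltrametricDist.norm_sum_le_of_forall_le_of_nonneg (norm_nonneg v) fun j _ => ?_
  rw [norm_mul]
  exact (mul_le_of_le_one_left (norm_nonneg _) (PadicInt.norm_le_one (M i j))).trans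
    (norm_le_pi_norm v j)

theorem norm_toPadic_mulVec {M : Matrix n n ℤ_[p]} (hM : IsUnit M.det) (v : n → ℚ_[p]) :
    ‖toPadic M *ᵥ v‖ = ‖v‖ := by
  refine (norm_toPadic_mulVec_le M v).antisymm ?_
  have h_inv : toPadic M⁻¹ *ᵥ toPadic M *ᵥ v = v := by
    rw [mulVec_mulVec, ← map_mul, nonsing_inv_mul M hM, map_one, one_mulVec]
  simpa only [h_inv] using norm_toPadic_mulVec_le M⁻¹ (toPadic M *ᵥ v)

theorem denseRange_of_norm_sub_eq {f : ℕ → ℤ_[p]}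
    (hf : ∀ s t, ‖f s - f t‖ = ‖(s - t : ℤ_[p])‖) : DenseRange f := by
  have toZModPow_eq_iff (k : ℕ) (x y : ℤ_[p]) :
      PadicInt.toZModPow k x = PadicInt.toZModPow k y ↔ ‖x - y‖ ≤ (p : ℝ) ^ (-k : ℤ) := by
    rw [← sub_eq_zero, ← map_sub, PadicInt.norm_le_pow_iff_mem_span_pow,
      ← PadicInt.ker_toZModPow, RingHom.mem_ker]
  refine Metric.dense_iff.mpr fun z r hr => ?_
  obtain ⟨k, hk⟩ := PadicInt.exists_pow_neg_lt p hr
  have : NeZero (p ^ k) := ⟨pow_ne_zero k (Fact.out : p.Prime).ne_zero⟩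
  let g (c : ZMod (p ^ k)) : ZMod (p ^ k) := PadicInt.toZModPow k (f c.val)
  have g_injective : g.Injective := fun c d h => by
    rw [toZModPow_eq_iff, hf, ← toZModPow_eq_iff, map_natCast, map_natCast] at h
    simpa only [ZMod.natCast_zmod_val] using h
  obtain ⟨c, hc⟩ := Finite.surjective_of_injective g_injective (PadicInt.toZModPow k z)
  refine ⟨f c.val, ?_, c.val, rfl⟩
  rw [Metric.mem_ball, dist_eq_norm]
  exact ((toZModPow_eq_iff k _ _).mp hc).trans_lt hk

theorem exists_pow_eq_one_add_smul {M : Matrix n n ℤ_[p]} (hM : IsUnit M.det) (q : ℕ) :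
    ∃ k, 0 < k ∧ ∃ E : Matrix n n ℤ_[p], M ^ k = 1 + (p : ℤ_[p]) ^ q • E := by
  have : NeZero (p ^ q) := ⟨pow_ne_zero q (Fact.out : p.Prime).ne_zero⟩
  let reduce : Matrix n n ℤ_[p] →+* Matrix n n (ZMod (p ^ q)) :=
    (PadicInt.toZModPow q).mapMatrix
  obtain ⟨u, hu⟩ := ((isUnit_iff_isUnit_det M).mpr hM).map reduce
  obtain ⟨k, hk, huk⟩ := isOfFinOrder_iff_pow_eq_one.mp (isOfFinOrder_of_finite u)
  have h_reduce : reduce (M ^ k - 1) = 0 := by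
    rw [map_sub, map_pow, map_one, ← hu, ← Units.val_pow_eq_pow_val, huk, Units.val_one, sub_self]
  have h_dvd (i j : n) : (p : ℤ_[p]) ^ q ∣ (M ^ k - 1) i j := by
    rw [← Ideal.mem_span_singleton, ← PadicInt.ker_toZModPow, RingHom.mem_ker]
    exact congrFun₂ h_reduce i j
  choose E hE using h_dvd
  refine ⟨k, hk, Matrix.of E, ?_⟩
  rw [← sub_eq_iff_eq_add']
  ext i j
  exact hE i j

variable {ℓ v : Fin 2 → ℚ_[p]} {E : Matrix (Fin 2) (Fin 2) ℤ_[p]}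

theorem norm_dotProduct_pow_mulVec_sub (hℓ : ‖ℓ ⬝ᵥ v‖ < ‖ℓ ⬝ᵥ toPadic E *ᵥ v‖) (s t : ℕ) :
    ‖ℓ ⬝ᵥ toPadic ((1 + (p : ℤ_[p]) ^ 2 • E) ^ s) *ᵥ v -
        ℓ ⬝ᵥ toPadic ((1 + (p : ℤ_[p]) ^ 2 • E) ^ t) *ᵥ v‖ =
      ‖(s - t : ℤ_[p])‖ * ‖(p : ℚ_[p]) ^ 2 * (ℓ ⬝ᵥ toPadic E *ᵥ v)‖ := by
  obtain ⟨a, b, hab⟩ := exists_one_add_sq_smul_pow_sub_pow_eq E s t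
  set L := ℓ ⬝ᵥ v
  set D := ℓ ⬝ᵥ toPadic E *ᵥ v
  have h_diff : ℓ ⬝ᵥ toPadic ((1 + (p : ℤ_[p]) ^ 2 • E) ^ s) *ᵥ v -
      ℓ ⬝ᵥ toPadic ((1 + (p : ℤ_[p]) ^ 2 • E) ^ t) *ᵥ v =
      (s - t : ℤ_[p]) * p ^ 2 * (D + p * (a * L + b * D)) := by
    rw [← dotProduct_sub, ← sub_mulVec, ← map_sub, hab]
    simp only [toPadic_smul, map_add, map_one, add_mulVec, smul_mulVec, one_mulVec,
      dotProduct_add, dotProduct_smul, smul_eq_mul, PadicInt.coe_mul, PadicInt.coe_pow,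
      PadicInt.coe_natCast, L, D]
  have h_small : ‖p * (a * L + b * D)‖ < ‖D‖ := by
    have h_comb : ‖a * L + b * D‖ ≤ ‖D‖ := by
      refine (Padic.nonarchimedean _ _).trans (max_le ?_ ?_) <;> rw [norm_mul]
      · exact (mul_le_of_le_one_left (norm_nonneg L) a.norm_le_one).trans hℓ.le
      · exact mul_le_of_le_one_left (norm_nonneg D) b.norm_le_one
    rw [norm_mul]
    exact (mul_le_mul_of_nonneg_left h_comb (norm_nonneg _)).trans_lt
      (mul_lt_of_lt_one_left ((norm_nonneg L).trans_lt hℓ) Padic.norm_p_lt_one)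
  have h_norm : ‖D + p * (a * L + b * D)‖ = ‖D‖ := by
    rw [Padic.add_eq_max_of_ne h_small.ne', max_eq_left h_small.le]
  rw [h_diff, norm_mul, norm_mul, h_norm, norm_mul, mul_assoc, PadicInt.padic_norm_e_of_padicInt]

theorem exists_norm_dotProduct_pow_mulVec_lt
    (hℓ : ‖ℓ ⬝ᵥ v‖ < ‖(p : ℚ_[p]) ^ 2 * (ℓ ⬝ᵥ toPadic E *ᵥ v)‖) {δ : ℝ} (hδ : 0 < δ) :
    ∃ t : ℕ, ‖ℓ ⬝ᵥ toPadic ((1 + (p : ℤ_[p]) ^ 2 • E) ^ t) *ᵥ v‖ < δ := by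
  set D := (p : ℚ_[p]) ^ 2 * (ℓ ⬝ᵥ toPadic E *ᵥ v) with hD
  let ψ (t : ℕ) : ℚ_[p] := ℓ ⬝ᵥ toPadic ((1 + (p : ℤ_[p]) ^ 2 • E) ^ t) *ᵥ v
  have D_pos : 0 < ‖D‖ := (norm_nonneg _).trans_lt hℓ
  have norm_ψ_sub (s t : ℕ) : ‖ψ s - ψ t‖ = ‖(s - t : ℤ_[p])‖ * ‖D‖ := by
    refine norm_dotProduct_pow_mulVec_sub (hℓ.trans_le ?_) s t
    rw [hD, norm_mul, norm_pow]
    exact mul_le_of_le_one_left (norm_nonneg _)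
      (pow_le_one₀ (norm_nonneg _) Padic.norm_p_lt_one.le)
  have norm_ψ_le (t : ℕ) : ‖ψ t‖ ≤ ‖D‖ := by
    have h_zero : ‖ψ 0‖ ≤ ‖D‖ := by
      simpa only [ψ, pow_zero, map_one, one_mulVec] using hℓ.le
    have h_sub : ‖ψ t - ψ 0‖ ≤ ‖D‖ := by
      rw [norm_ψ_sub]
      exact mul_le_of_le_one_left (norm_nonneg D) (PadicInt.norm_le_one _)
    rw [← sub_add_cancel (ψ t) (ψ 0)]
    exact (Padic.nonarchimedean _ _).trans (max_le h_sub h_zero)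
  let f (t : ℕ) : ℤ_[p] := ⟨ψ t / D, by
    rw [norm_div]
    exact div_le_one_of_le₀ (norm_ψ_le t) (norm_nonneg D)⟩
  have f_dense : DenseRange f := denseRange_of_norm_sub_eq fun s t => by
    rw [PadicInt.norm_def, PadicInt.coe_sub]
    change ‖ψ s / D - ψ t / D‖ = _
    rw [← sub_div, norm_div, norm_ψ_sub, mul_div_cancel_right₀ _ D_pos.ne']
  obtain ⟨t, ht⟩ := f_dense.exists_dist_lt 0 (div_pos hδ D_pos)
  refine ⟨t, ?_⟩
  rw [dist_zero_left, PadicInt.norm_def] at ht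
  change ‖ψ t / D‖ < _ at ht
  rwa [norm_div, div_lt_div_iff_of_pos_right D_pos] at ht

end Orbit

section Eigenpoint

variable {K : Type*} [Field K] {M : Matrix (Fin 2) (Fin 2) K}

/-- Rotation of the plane by a right angle. A vector is proportional to `v ≠ 0` exactly if it is
annihilated by `perp v`. -/
def perp : (Fin 2 → K) →ₗ[K] (Fin 2 → K) where
  toFun v := ![v 1, -v 0]
  map_add' u v := by simp [add_comm]
  map_smul' c v := by simp

theorem perp_dotProduct (v u : Fin 2 → K) : perp v ⬝ᵥ u = v 1 * u 0 - v 0 * u 1 := by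
  simp [perp, dotProduct, Fin.sum_univ_two, sub_eq_add_neg]

theorem perp_dotProduct_self (v : Fin 2 → K) : perp v ⬝ᵥ v = 0 := by
  rw [perp_dotProduct, mul_comm, sub_self]

theorem perp_perp (v : Fin 2 → K) : perp (perp v) = -v := by
  ext i
  fin_cases i <;> simp [perp]

theorem perp_injective : Function.Injective (perp : (Fin 2 → K) →ₗ[K] (Fin 2 → K)) := by
  intro u v h
  rw [← neg_inj, ← perp_perp, h, perp_perp]

theorem perp_dotProduct_eq_zero_iff {v u : Fin 2 → K} (hv : v ≠ 0) :
    perp v ⬝ᵥ u = 0 ↔ ∃ c : K, u = c • v := by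
  rw [perp_dotProduct]
  constructor
  · intro h
    have h_cross : ∀ i j, u j * v i = u i * v j := by
      simp only [Fin.forall_fin_two, true_and, and_true]
      exact ⟨by linear_combination -h, by linear_combination h⟩
    obtain ⟨i, hi⟩ := Function.ne_iff.mp hv
    refine ⟨u i / v i, funext fun j => ?_⟩
    rw [Pi.smul_apply, smul_eq_mul, div_mul_eq_mul_div, eq_div_iff hi, h_cross]
  · rintro ⟨c, rfl⟩
    simp only [Pi.smul_apply, smul_eq_mul]
    ring

theorem mk_eq_mk_iff_perp_dotProduct_eq_zero {u v : Fin 2 → K} (hu : u ≠ 0) (hv : v ≠ 0) :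
    Projectivization.mk K u hu = Projectivization.mk K v hv ↔ perp v ⬝ᵥ u = 0 := by
  simp only [Projectivization.mk_eq_mk_iff', perp_dotProduct_eq_zero_iff hv, eq_comm]

theorem isEigenpoint_mk_iff {v : Fin 2 → K} (hv : v ≠ 0) :
    IsEigenpoint M (Projectivization.mk K v hv) ↔ perp v ⬝ᵥ M *ᵥ v = 0 := by
  rw [isEigenpoint_mk, perp_dotProduct_eq_zero_iff hv]

theorem isEigenpoint_iff {x : Projectivization K (Fin 2 → K)} :
    IsEigenpoint M x ↔ perp x.rep ⬝ᵥ M *ᵥ x.rep = 0 :=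
  (perp_dotProduct_eq_zero_iff x.rep_nonzero).symm

theorem isEigenpoint_smul_one_add_smul_iff {a b : K} (hb : b ≠ 0)
    {x : Projectivization K (Fin 2 → K)} :
    IsEigenpoint (a • 1 + b • M) x ↔ IsEigenpoint M x := by
  rw [isEigenpoint_iff, isEigenpoint_iff, add_mulVec, smul_mulVec, smul_mulVec, one_mulVec,
    dotProduct_add, dotProduct_smul, dotProduct_smul, perp_dotProduct_self, smul_zero, zero_add,
    smul_eq_zero_iff_right hb]

theorem transpose_ne_smul_one (hM : ∀ s : K, M ≠ s • 1) (s : K) : Mᵀ ≠ s • 1 := fun h =>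
  hM s (by rw [← transpose_transpose M, h, transpose_smul, transpose_one])

theorem ne_smul_one_of_map_ne_smul_one {L : Type*} [Field L] (f : K →+* L)
    (hM : ∀ s : L, M.map f ≠ s • 1) (s : K) : M ≠ s • 1 := fun h => hM (f s) <| by
  rw [h, smul_one_eq_diagonal, smul_one_eq_diagonal, diagonal_map (map_zero f)]

theorem IsEigenpoint.of_pow {x : Projectivization K (Fin 2 → K)} {k : ℕ}
    (hM : ∀ s : K, M ^ k ≠ s • 1) (hx : IsEigenpoint (M ^ k) x) : IsEigenpoint M x := by
  obtain ⟨a, b, hab⟩ := exists_aeval_eq_smul_one_add_smul M (Polynomial.X ^ k)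
  rw [map_pow, Polynomial.aeval_X] at hab
  rw [hab] at hx
  refine (isEigenpoint_smul_one_add_smul_iff ?_).mp hx
  rintro rfl
  exact hM a (by rw [hab, zero_smul, add_zero])

theorem eq_smul_one_of_mulVec_eq_smul {u v : Fin 2 → K} (huv : LinearIndependent K ![u, v])
    {c : K} (hu : M *ᵥ u = c • u) (hv : M *ᵥ v = c • v) : M = c • 1 := by
  refine toLin'.injective ((basisOfLinearIndependentOfCardEqFinrank huv (by simp)).ext fun i => ?_)
  fin_cases i <;> simp [hu, hv]

theorem IsEigenpoint.eq_or_eq (hM : ∀ s : K, M ≠ s • 1) {x y z : Projectivization K (Fin 2 → K)}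
    (hxy : x ≠ y) (hx : IsEigenpoint M x) (hy : IsEigenpoint M y) (hz : IsEigenpoint M z) :
    z = x ∨ z = y := by
  obtain ⟨α, hα⟩ := hx
  obtain ⟨β, hβ⟩ := hy
  obtain ⟨γ, hγ⟩ := hz
  have hli := Projectivization.linearIndependent_pair_iff_ne.mpr hxy
  obtain ⟨a, b, hab⟩ : ∃ a b : K, a • x.rep + b • y.rep = z.rep := by
    rw [← Submodule.mem_span_pair, ← range_cons_cons_empty,
      hli.span_eq_top_of_card_eq_finrank (by simp)]
    trivial
  rw [← hab, mulVec_add, mulVec_smul, mulVec_smul, hα, hβ, smul_add] at hγ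
  simp only [smul_smul] at hγ
  obtain ⟨h_left, h_right⟩ := hli.eq_of_pair hγ
  rcases eq_or_ne b 0 with rfl | hb
  · left
    rw [← z.mk_rep, ← x.mk_rep, Projectivization.mk_eq_mk_iff']
    exact ⟨a, by rw [← hab, zero_smul, add_zero]⟩
  rcases eq_or_ne a 0 with rfl | ha
  · right
    rw [← z.mk_rep, ← y.mk_rep, Projectivization.mk_eq_mk_iff']
    exact ⟨b, by rw [← hab, zero_smul, zero_add]⟩
  rw [mul_comm, mul_left_inj' ha] at h_left
  rw [mul_comm, mul_left_inj' hb] at h_right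
  subst h_left h_right
  exact absurd (eq_smul_one_of_mulVec_eq_smul hli hα hβ) (hM _)

/-- The image of a point of the projective line under `perp`: it maps the eigenpoints of a matrix
to those of its transpose. -/
def perpPoint : Projectivization K (Fin 2 → K) → Projectivization K (Fin 2 → K) :=
  Projectivization.map perp perp_injective

theorem perpPoint_injective :
    Function.Injective (perpPoint : Projectivization K (Fin 2 → K) → _) :=
  Projectivization.map_injective _ _

theorem IsEigenpoint.transpose {x : Projectivization K (Fin 2 → K)} (hx : IsEigenpoint M x) :
    IsEigenpoint Mᵀ (perpPoint x) := by
  induction x using Projectivization.ind with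
  | h v hv =>
    rw [isEigenpoint_mk_iff] at hx
    rw [perpPoint, Projectivization.map_mk, isEigenpoint_mk_iff, perp_perp, neg_dotProduct,
      dotProduct_mulVec, vecMul_transpose, dotProduct_comm, hx, neg_zero]

theorem exists_isEigenpoint_transpose_iff (hM : ∀ s : K, M ≠ s • 1)
    {v₁ v₂ : Projectivization K (Fin 2 → K)} (hv : v₁ ≠ v₂) (h₁ : IsEigenpoint M v₁)
    (h₂ : IsEigenpoint M v₂) :
    ∃ w₁ w₂, w₁ ≠ w₂ ∧ ∀ x, IsEigenpoint Mᵀ x ↔ x = w₁ ∨ x = w₂ := by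
  refine ⟨perpPoint v₁, perpPoint v₂, perpPoint_injective.ne hv, fun x => ⟨?_, ?_⟩⟩
  · exact IsEigenpoint.eq_or_eq (transpose_ne_smul_one hM) (perpPoint_injective.ne hv)
      h₁.transpose h₂.transpose
  · rintro (rfl | rfl)
    exacts [h₁.transpose, h₂.transpose]

end Eigenpoint

section AlgCl

variable {p : ℕ} [Fact p.Prime]

theorem pointToAlgCl_mk {v : Fin 2 → ℚ_[p]} (hv : v ≠ 0) :
    pointToAlgCl p (Projectivization.mk ℚ_[p] v hv) =
      Projectivization.mk _ (planeToAlgCl p v)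
        ((map_ne_zero_iff _ (planeToAlgCl_injective p)).mpr hv) :=
  Projectivization.map_mk _ _ _ _

theorem perp_planeToAlgCl_dotProduct (v u : Fin 2 → ℚ_[p]) :
    perp (planeToAlgCl p v) ⬝ᵥ planeToAlgCl p u = algebraMap _ _ (perp v ⬝ᵥ u) := by
  rw [perp_dotProduct, perp_dotProduct, map_sub, map_mul, map_mul]
  rfl

theorem pointToAlgCl_injective : Function.Injective (pointToAlgCl p) := by
  intro x y h
  induction x using Projectivization.ind with | h u hu
  induction y using Projectivization.ind with | h v hv
  rw [pointToAlgCl_mk, pointToAlgCl_mk, mk_eq_mk_iff_perp_dotProduct_eq_zero,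
    perp_planeToAlgCl_dotProduct, map_eq_zero] at h
  exact (mk_eq_mk_iff_perp_dotProduct_eq_zero hu hv).mpr h

theorem isEigenpoint_pointToAlgCl_iff {M : Matrix (Fin 2) (Fin 2) ℚ_[p]}
    {x : Projectivization ℚ_[p] (Fin 2 → ℚ_[p])} :
    IsEigenpoint (M.map (algebraMap ℚ_[p] (PadicAlgCl p))) (pointToAlgCl p x) ↔
      IsEigenpoint M x := by
  induction x using Projectivization.ind with
  | h v hv =>
    have h_map : M.map (algebraMap ℚ_[p] (PadicAlgCl p)) *ᵥ planeToAlgCl p v =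
        planeToAlgCl p (M *ᵥ v) :=
      funext fun i => (RingHom.map_mulVec (algebraMap ℚ_[p] (PadicAlgCl p)) M v i).symm
    rw [pointToAlgCl_mk, isEigenpoint_mk_iff, isEigenpoint_mk_iff, h_map,
      perp_planeToAlgCl_dotProduct, map_eq_zero]

end AlgCl

section BadCone

variable {p : ℕ} [Fact p.Prime] {ι : Type*} [Fintype ι] {ε : ℝ} {v : ι → ℚ_[p]}

variable (p ι) in
/-- The affine cone over `PBadEps p ε`, in any dimension, with the origin included to make it
closed. -/
def badCone (ε : ℝ) : Set (ι → ℚ_[p]) :=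
  {v | ∀ ℓ : ι → ℤ, ℓ ≠ 0 → ε * ‖v‖ ≤ ‖(fun i => (ℓ i : ℚ_[p])) ⬝ᵥ v‖ * ‖ℓ‖ ^ 2}

theorem isClosed_badCone : IsClosed (badCone p ι ε) := by
  simp only [badCone, Set.ofPred_forall]
  exact isClosed_iInter fun ℓ => isClosed_iInter fun _ =>
    isClosed_le (by fun_prop) ((continuous_const.dotProduct continuous_id).norm.mul_const _)

theorem eq_zero_of_mem_badCone (hε : 0 < ε) (hv : v ∈ badCone p ι ε) {ℓ : ι → ℤ} (hℓ : ℓ ≠ 0)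
    (h : (fun i => (ℓ i : ℚ_[p])) ⬝ᵥ v = 0) : v = 0 := by
  have h_le := hv ℓ hℓ
  rw [h, norm_zero, zero_mul] at h_le
  exact norm_le_zero_iff.mp (nonpos_of_mul_nonpos_right h_le hε)

theorem norm_fin_two {E : Type*} [SeminormedAddGroup E] (u : Fin 2 → E) :
    ‖u‖ = max ‖u 0‖ ‖u 1‖ := by
  simp [Pi.norm_def, Finset.univ_fin2]

theorem mk_mem_PBadEps_iff_mem_badCone {v : Fin 2 → ℚ_[p]} (hv : v ≠ 0) :
    Projectivization.mk ℚ_[p] v hv ∈ PBadEps p ε ↔ v ∈ badCone p (Fin 2) ε := by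
  rw [mk_mem_PBadEps, ← norm_fin_two]
  refine Iff.trans ?_ (finTwoArrowEquiv ℤ).forall_congr_left.symm
  rw [Prod.forall]
  refine forall₂_congr fun a b => ?_
  simp [norm_fin_two, dotProduct, Fin.sum_univ_two, funext_iff, Fin.forall_fin_two,
    Int.norm_eq_abs]

theorem exists_intCast_mem {ι : Type*} [Finite ι] {U : Set (ι → ℚ_[p])} (hU : IsOpen U)
    (h_ne : U.Nonempty) (h_smul : ∀ c : ℚ_[p], c ≠ 0 → ∀ u ∈ U, c • u ∈ U) :
    ∃ ℓ : ι → ℤ, (fun i => (ℓ i : ℚ_[p])) ∈ U := by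
  have h_dense : DenseRange (Pi.map fun _ : ι => ((↑) : ℚ → ℚ_[p])) :=
    DenseRange.piMap fun _ => Padic.denseRange_ratCast p
  obtain ⟨q, hq⟩ := h_dense.exists_mem_open hU h_ne
  obtain ⟨d, hd⟩ := IsLocalization.exist_integer_multiples_of_finite (nonZeroDivisors ℤ) q
  choose ℓ hℓ using hd
  refine ⟨ℓ, ?_⟩
  convert h_smul (d : ℤ) (Int.cast_ne_zero.mpr (nonZeroDivisors.coe_ne_zero d)) _ hq using 1
  ext i
  have := congrArg ((↑) : ℚ → ℚ_[p]) (hℓ i)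
  simpa using this

theorem perp_dotProduct_mulVec_eq_zero_of_pow_mulVec_mem_badCone
    {E : Matrix (Fin 2) (Fin 2) ℤ_[p]} (hE : IsUnit (1 + (p : ℤ_[p]) ^ 2 • E).det) (hε : 0 < ε)
    {v : Fin 2 → ℚ_[p]}
    (hv : ∀ t, toPadic ((1 + (p : ℤ_[p]) ^ 2 • E) ^ t) *ᵥ v ∈ badCone p (Fin 2) ε) :
    perp v ⬝ᵥ toPadic E *ᵥ v = 0 := by
  by_contra h_perp
  have v_ne : v ≠ 0 := by
    rintro rfl
    simp at h_perp
  have p_ne : (p : ℚ_[p]) ≠ 0 := Nat.cast_ne_zero.mpr (Fact.out : p.Prime).ne_zero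
  let U : Set (Fin 2 → ℚ_[p]) := {ℓ | ‖ℓ ⬝ᵥ v‖ < ‖(p : ℚ_[p]) ^ 2 * (ℓ ⬝ᵥ toPadic E *ᵥ v)‖}
  have U_open : IsOpen U := isOpen_lt (by fun_prop) (by fun_prop)
  have perp_mem : perp v ∈ U := by
    rw [Set.mem_ofPred_eq, perp_dotProduct_self, norm_zero, norm_pos_iff]
    exact mul_ne_zero (pow_ne_zero 2 p_ne) h_perp
  obtain ⟨ℓ, hℓ⟩ := exists_intCast_mem U_open ⟨_, perp_mem⟩ fun c hc u hu => by
    rw [Set.mem_ofPred_eq, smul_dotProduct, smul_dotProduct, mul_smul_comm, norm_smul, norm_smul]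
    exact mul_lt_mul_of_pos_left hu (norm_pos_iff.mpr hc)
  have ℓ_ne : ℓ ≠ 0 := by
    rintro rfl
    have h_lt : ‖_‖ < ‖_‖ := hℓ
    simp [dotProduct] at h_lt
  have ℓ_pos : 0 < ‖ℓ‖ ^ 2 := by positivity
  obtain ⟨t, ht⟩ := exists_norm_dotProduct_pow_mulVec_lt hℓ
    (div_pos (mul_pos hε (norm_pos_iff.mpr v_ne)) ℓ_pos)
  have h_bad := hv t ℓ ℓ_ne
  rw [norm_toPadic_mulVec (by rw [det_pow]; exact hE.pow t)] at h_bad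
  exact h_bad.not_gt ((lt_div_iff₀ ℓ_pos).mp ht)

end BadCone

section Words

theorem wordMat_append (u v : List ℕ) : wordMat (u ++ v) = wordMat u * wordMat v := by
  rw [wordMat, List.map_append, List.prod_append, wordMat, wordMat]

theorem wordPrefix_add (w : ℕ → ℕ) (m n : ℕ) :
    wordPrefix w (m + n) = wordPrefix w m ++ wordPrefix (shift m w) n := by
  simp [wordPrefix, List.range_add, shift, Function.comp_def]

theorem wordPrefix_eq_iff {u w : ℕ → ℕ} {n : ℕ} :
    wordPrefix u n = wordPrefix w n ↔ ∀ i < n, u i = w i := by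
  simp [wordPrefix]

theorem one_mem_V (w : ℕ → ℕ) (n : ℕ) : 1 ∈ V n w :=
  ⟨0, wordPrefix_eq_iff.mpr fun i _ => congrArg w (zero_add i), rfl⟩

theorem mul_mem_V {w : ℕ → ℕ} {n m : ℕ} {M : Matrix (Fin 2) (Fin 2) ℤ}
    (hm : wordPrefix (shift m w) n = wordPrefix w n) (hM : M ∈ V (m + n) w) :
    M * wordMat (wordPrefix w m) ∈ V n w := by
  obtain ⟨l, hl, rfl⟩ := hM
  rw [wordPrefix_eq_iff] at hm hl
  have h_append : wordPrefix w (l + m) = wordPrefix w l ++ wordPrefix w m := by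
    rw [wordPrefix_add, wordPrefix_eq_iff.mpr fun i hi => hl i (by omega)]
  refine ⟨l + m, wordPrefix_eq_iff.mpr fun i hi => ?_, by rw [h_append, wordMat_append]⟩
  calc w (l + m + i) = w (m + i) := by rw [add_assoc]; exact hl (m + i) (by omega)
    _ = w i := hm i hi

theorem wordMat_wordPrefix_succ (w : ℕ → ℕ) (n : ℕ) :
    wordMat (wordPrefix w (n + 1)) = wordMat (wordPrefix w n) * letterMat (w n) := by
  rw [wordPrefix_add, wordMat_append]
  simp [wordMat, wordPrefix, shift]

theorem transpose_letterMat (a : ℕ) : (letterMat a)ᵀ = letterMat a := by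
  ext i j
  fin_cases i <;> fin_cases j <;> rfl

variable {p : ℕ} [Fact p.Prime] {w : ℕ → ℕ}

theorem one_mem_Vp : (1 : Matrix (Fin 2) (Fin 2) ℤ_[p]) ∈ Vp p w :=
  Set.mem_iInter₂.mpr fun n _ =>
    subset_closure ⟨1, one_mem_V w n, Matrix.map_one _ Int.cast_zero Int.cast_one⟩

theorem mul_mem_Vp {A B : Matrix (Fin 2) (Fin 2) ℤ_[p]} (hA : A ∈ Vp p w) (hB : B ∈ Vp p w) :
    A * B ∈ Vp p w := by
  refine Set.mem_iInter₂.mpr fun n hn => ?_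
  have h_maps : Set.MapsTo (A * ·) (VpLevel p n w) (closure (VpLevel p n w)) := by
    rintro _ ⟨_, ⟨m, hm, rfl⟩, rfl⟩
    refine map_mem_closure (f := (· * (wordMat (wordPrefix w m)).map (Int.cast : ℤ → ℤ_[p])))
      (by fun_prop) (Set.mem_iInter₂.mp hA (m + n) (Set.mem_Ici.mpr (le_add_left hn))) ?_
    rintro _ ⟨M, hM, rfl⟩
    exact ⟨_, mul_mem_V hm hM, Matrix.map_mul (f := Int.castRingHom ℤ_[p])⟩
  simpa only [closure_closure] using
    map_mem_closure (by fun_prop) (Set.mem_iInter₂.mp hB n hn) h_maps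

theorem pow_mem_Vp {A : Matrix (Fin 2) (Fin 2) ℤ_[p]} (hA : A ∈ Vp p w) (k : ℕ) :
    A ^ k ∈ Vp p w := by
  induction k with
  | zero => exact (pow_zero A).symm ▸ one_mem_Vp
  | succ k ih => exact (pow_succ A k).symm ▸ mul_mem_Vp ih hA

theorem shiftPair_iterate (w : ℕ → ℕ) {v : Fin 2 → ℚ_[p]} (hv : v ≠ 0) (n : ℕ) :
    ∃ h, (shiftPair p)^[n] (w, Projectivization.mk ℚ_[p] v hv) =
      (shift n w, Projectivization.mk ℚ_[p]
        ((wordMat (wordPrefix w n))ᵀ.map (Int.cast : ℤ → ℚ_[p]) *ᵥ v) h) := by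
  induction n with
  | zero =>
    have h_zero : (wordMat (wordPrefix w 0))ᵀ.map (Int.cast : ℤ → ℚ_[p]) *ᵥ v = v := by
      simp [wordMat, wordPrefix]
    simp only [h_zero]
    exact ⟨hv, Prod.ext (funext fun i => congrArg w (zero_add i).symm) rfl⟩
  | succ n ih =>
    obtain ⟨h, ih⟩ := ih
    have h_succ : (wordMat (wordPrefix w (n + 1)))ᵀ.map (Int.cast : ℤ → ℚ_[p]) *ᵥ v =
        (letterMat (w n)).map (Int.cast : ℤ → ℚ_[p]) *ᵥ
          (wordMat (wordPrefix w n))ᵀ.map (Int.cast : ℤ → ℚ_[p]) *ᵥ v := by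
      rw [wordMat_wordPrefix_succ, transpose_mul, transpose_letterMat, mulVec_mulVec]
      exact congrArg (· *ᵥ v) (Matrix.map_mul (f := Int.castRingHom ℚ_[p]))
    simp only [h_succ]
    refine ⟨(map_ne_zero_iff _ (letterMat_injective p (w n))).mpr h, ?_⟩
    rw [Function.iterate_succ_apply', ih]
    exact Prod.ext (funext fun i => congrArg w (add_assoc n 1 i).symm)
      (Projectivization.map_mk _ (letterMat_injective p (w n)) _ h)

theorem transpose_mulVec_mem_badCone {ε : ℝ} {x : Projectivization ℚ_[p] (Fin 2 → ℚ_[p])}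
    (hx : (w, x) ∈ LMadEps p ε) {B : Matrix (Fin 2) (Fin 2) ℤ_[p]} (hB : B ∈ Vp p w) :
    toPadic Bᵀ *ᵥ x.rep ∈ badCone p (Fin 2) ε := by
  have h_cont : Continuous fun M : Matrix (Fin 2) (Fin 2) ℤ_[p] => toPadic Mᵀ *ᵥ x.rep :=
    (continuous_toPadic.comp continuous_id.matrix_transpose).matrix_mulVec continuous_const
  rw [← isClosed_badCone.closure_eq]
  refine map_mem_closure (f := fun M => toPadic Mᵀ *ᵥ x.rep) h_cont
    (Set.mem_iInter₂.mp hB 1 (Set.mem_Ici.mpr le_rfl)) ?_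
  rintro _ ⟨_, ⟨n, -, rfl⟩, rfl⟩
  obtain ⟨h, h_iter⟩ := shiftPair_iterate w x.rep_nonzero n
  have h_bad := (hx n).2
  rw [← x.mk_rep, h_iter, mk_mem_PBadEps_iff_mem_badCone] at h_bad
  convert h_bad using 2
  ext i j
  simp [toPadic]

end Words

section SLtilde

variable {p : ℕ} [Fact p.Prime] {A : Matrix (Fin 2) (Fin 2) ℤ_[p]}

theorem IsEigenpoint.exists_hasEigenvector {K : Type*} [Field K] {M : Matrix (Fin 2) (Fin 2) K}
    {x : Projectivization K (Fin 2 → K)} (hx : IsEigenpoint M x) :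
    ∃ μ, Module.End.HasEigenvector (toLin' M) μ x.rep := by
  obtain ⟨μ, hμ⟩ := hx
  exact ⟨μ, Module.End.mem_eigenspace_iff.mpr hμ, x.rep_nonzero⟩

theorem isUnit_det_of_mem_SLpm (hA : A ∈ SLpm p) : IsUnit A.det := by
  rcases hA with h | h <;> rw [h]
  exacts [isUnit_one, isUnit_one.neg]

theorem mapMatrix_toPadic (A : Matrix (Fin 2) (Fin 2) ℤ_[p]) :
    (algebraMap ℚ_[p] (PadicAlgCl p)).mapMatrix (toPadic A) = toAlgCl p A :=
  rfl

theorem det_toAlgCl_sq (hA : A ∈ SLpm p) : (toAlgCl p A).det ^ 2 = 1 := by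
  rw [← mapMatrix_toPadic, ← RingHom.map_det, toPadic, ← RingHom.map_det]
  rcases hA with h | h <;> simp [h]

theorem norm_pow_kappa_sub_one_lt {μ : PadicAlgCl p}
    (hμ : Module.End.HasEigenvalue (toLin' (toAlgCl p A)) μ) : ‖μ ^ kappa p A - 1‖ < 1 := by
  rcases Set.eq_empty_or_nonempty {k : ℕ | 0 < k ∧ ∀ μ : PadicAlgCl p,
    Module.End.HasEigenvalue (toLin' (toAlgCl p A)) μ → ‖μ ^ k - 1‖ ≤ (p : ℝ)⁻¹} with h | h
  · -- Then `kappa p A` is the junk value `sInf ∅ = 0`.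
    rw [kappa, h, Nat.sInf_empty, pow_zero, sub_self, norm_zero]
    exact zero_lt_one
  · exact ((Nat.sInf_mem h).2 μ hμ).trans_lt
      (inv_lt_one_of_one_lt₀ (mod_cast (Fact.out : p.Prime).one_lt))

theorem pow_ne_one_of_mem_SLtilde (hA : A ∈ SLtilde p) {μ : PadicAlgCl p}
    (hμ : Module.End.HasEigenvalue (toLin' (toAlgCl p A)) μ) {n : ℕ} (hn : n ≠ 0) : μ ^ n ≠ 1 :=
  fun h => hA.2 μ hμ <| padicLog_eq_zero_of_pow_eq_one (norm_pow_kappa_sub_one_lt hμ) hn <| by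
    rw [pow_right_comm, h, one_pow]

theorem toAlgCl_pow_ne_smul_one (hA : A ∈ SLtilde p) {k : ℕ} (hk : k ≠ 0) (s : PadicAlgCl p) :
    toAlgCl p A ^ k ≠ s • 1 := by
  intro h_scalar
  obtain ⟨v, -, -, hv, -⟩ := hA.1.2
  obtain ⟨μ, hμ⟩ := hv.exists_hasEigenvector
  have μ_pow : μ ^ k = s := by
    refine smul_left_injective _ v.rep_nonzero ?_
    simpa only [← toLin'_pow, h_scalar, toLin'_apply, smul_mulVec, one_mulVec] using
      (hμ.pow_apply k).symm
  have s_pow : s ^ 4 = 1 := by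
    have h_det : (toAlgCl p A).det ^ k = s ^ 2 := by
      rw [← det_pow, h_scalar, det_smul, det_one, mul_one, Fintype.card_fin]
    rw [show s ^ 4 = (s ^ 2) ^ 2 by ring, ← h_det, pow_right_comm, det_toAlgCl_sq hA.1.1, one_pow]
  refine pow_ne_one_of_mem_SLtilde hA (Module.End.hasEigenvalue_of_hasEigenvector hμ)
    (mul_ne_zero hk four_ne_zero) ?_
  rw [pow_mul, μ_pow, s_pow]

theorem toPadic_pow_ne_smul_one (hA : A ∈ SLtilde p) {k : ℕ} (hk : k ≠ 0) :
    ∀ s : ℚ_[p], toPadic A ^ k ≠ s • 1 := by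
  refine ne_smul_one_of_map_ne_smul_one (algebraMap ℚ_[p] (PadicAlgCl p)) fun s => ?_
  rw [← RingHom.mapMatrix_apply, map_pow, mapMatrix_toPadic]
  exact toAlgCl_pow_ne_smul_one hA hk s

end SLtilde

section LMad

variable {p : ℕ} [Fact p.Prime] {A : Matrix (Fin 2) (Fin 2) ℤ_[p]} {w : ℕ → ℕ}
  {x : Projectivization ℚ_[p] (Fin 2 → ℚ_[p])}

theorem isEigenpoint_transpose_of_mem_LMad (hx : (w, x) ∈ LMad p) (hV : A ∈ Vp p w)
    (h_det : IsUnit A.det) (h_pow : ∀ k ≠ 0, ∀ s : ℚ_[p], toPadic A ^ k ≠ s • 1) :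
    IsEigenpoint (toPadic A)ᵀ x := by
  obtain ⟨ε, hε, hx⟩ := hx
  obtain ⟨k, hk, E, hE⟩ := exists_pow_eq_one_add_smul (det_transpose A ▸ h_det) 2
  have h_orbit (t : ℕ) :
      toPadic ((1 + (p : ℤ_[p]) ^ 2 • E) ^ t) *ᵥ x.rep ∈ badCone p (Fin 2) ε := by
    rw [← hE, ← pow_mul, ← transpose_pow]
    exact transpose_mulVec_mem_badCone hx (pow_mem_Vp hV (k * t))
  have h_isUnit : IsUnit (1 + (p : ℤ_[p]) ^ 2 • E).det := by
    rw [← hE, det_pow, det_transpose]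
    exact h_det.pow k
  have hEx : IsEigenpoint (toPadic E) x := isEigenpoint_iff.mpr
    (perp_dotProduct_mulVec_eq_zero_of_pow_mulVec_mem_badCone h_isUnit hε h_orbit)
  have h_pow_eq : (toPadic A)ᵀ ^ k = (1 : ℚ_[p]) • 1 + (p : ℚ_[p]) ^ 2 • toPadic E := by
    rw [one_smul, show (toPadic A)ᵀ = toPadic Aᵀ from rfl, ← map_pow, hE, map_add, map_one,
      toPadic_smul, PadicInt.coe_pow, PadicInt.coe_natCast]
  refine IsEigenpoint.of_pow (k := k) ?_ ?_
  · rw [← transpose_pow]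
    exact transpose_ne_smul_one (h_pow k hk.ne')
  · rw [h_pow_eq]
    refine (isEigenpoint_smul_one_add_smul_iff (pow_ne_zero 2 ?_)).mpr hEx
    exact Nat.cast_ne_zero.mpr (Fact.out : p.Prime).ne_zero

theorem eq_zero_of_mem_LMad (hx : (w, x) ∈ LMad p) (ℓ : Fin 2 → ℤ)
    (h : (fun i => (ℓ i : ℚ_[p])) ⬝ᵥ x.rep = 0) : ℓ = 0 := by
  obtain ⟨ε, hε, hx⟩ := hx
  by_contra hℓ
  have h_bad : x.rep ∈ badCone p (Fin 2) ε := by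
    rw [← mk_mem_PBadEps_iff_mem_badCone x.rep_nonzero, x.mk_rep]
    exact (hx 0).2
  exact x.rep_nonzero (eq_zero_of_mem_badCone hε h_bad hℓ h)

theorem rep_one_ne_zero_of_mem_LMad (hx : (w, x) ∈ LMad p) : x.rep 1 ≠ 0 := fun h => by
  have := eq_zero_of_mem_LMad hx ![0, 1] (by simp [dotProduct, Fin.sum_univ_two, h])
  simp at this

theorem affineCoord_ne_ratCast_of_mem_LMad (hx : (w, x) ∈ LMad p) (r : ℚ) :
    affineCoord p x ≠ (r : ℚ_[p]) := by
  intro hr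
  rw [affineCoord, div_eq_iff (rep_one_ne_zero_of_mem_LMad hx)] at hr
  have den_ne : (r.den : ℚ_[p]) ≠ 0 := Nat.cast_ne_zero.mpr r.den_ne_zero
  have := eq_zero_of_mem_LMad hx ![r.den, -r.num] (by
    simp only [dotProduct, Fin.sum_univ_two, cons_val_zero, cons_val_one, hr, Rat.cast_def r,
      Int.cast_neg, Int.cast_natCast]
    field_simp
    ring)
  simp at this

open Polynomial in
theorem IsEigenpoint.isIntegral_and_natDegree_minpoly_le_two {F L : Type*} [Field F] [Field L]
    [Algebra F L] {M : Matrix (Fin 2) (Fin 2) F} (hM : ∀ s : F, M ≠ s • 1)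
    {x : Projectivization L (Fin 2 → L)} (hx : IsEigenpoint (M.map (algebraMap F L)) x)
    (hx₁ : x.rep 1 ≠ 0) :
    IsIntegral F (x.rep 0 / x.rep 1) ∧ (minpoly F (x.rep 0 / x.rep 1)).natDegree ≤ 2 := by
  let P : F[X] := C (M 1 0) * X ^ 2 + C (M 1 1 - M 0 0) * X + C (-M 0 1)
  have P_ne : P ≠ 0 := fun hP => by
    have coeff_P : P.coeff 2 = M 1 0 ∧ P.coeff 1 = M 1 1 - M 0 0 ∧ P.coeff 0 = -M 0 1 := by
      simp [P, coeff_X, coeff_C]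
    simp only [hP, coeff_zero, eq_comm (a := (0 : F)), sub_eq_zero, neg_eq_zero] at coeff_P
    obtain ⟨h₁₀, h₁₁, h₀₁⟩ := coeff_P
    refine hM (M 0 0) ?_
    ext i j
    fin_cases i <;> fin_cases j <;> simp [h₁₀, h₁₁, h₀₁]
  have P_root : aeval (x.rep 0 / x.rep 1) P = 0 := by
    rw [isEigenpoint_iff, perp_dotProduct] at hx
    simp only [mulVec, dotProduct, map_apply, Fin.sum_univ_two] at hx
    simp only [P, map_add, map_sub, map_neg, map_mul, map_pow, aeval_C, aeval_X]
    field_simp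
    linear_combination -hx
  exact ⟨IsAlgebraic.isIntegral ⟨P, P_ne, P_root⟩,
    (natDegree_le_of_dvd (minpoly.dvd F _ P_root) P_ne).trans natDegree_quadratic_le⟩

theorem isEigenpoint_transpose_of_mem_SLtilde (hA : A ∈ SLtilde p) (hV : A ∈ Vp p w)
    (hx : (w, x) ∈ LMad p) : IsEigenpoint (toPadic A)ᵀ x :=
  isEigenpoint_transpose_of_mem_LMad hx hV (isUnit_det_of_mem_SLpm hA.1.1) fun _ =>
    toPadic_pow_ne_smul_one hA

theorem isIntegral_and_natDegree_minpoly_affineCoord_le_two {F : Type*} [Field F]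
    [Algebra F ℚ_[p]] (hA : A ∈ SLtilde p) (hV : A ∈ Vp p w) (hx : (w, x) ∈ LMad p)
    (hF : ∀ i j, ∃ a : F, algebraMap F ℚ_[p] a = A i j) :
    IsIntegral F (affineCoord p x) ∧ (minpoly F (affineCoord p x)).natDegree ≤ 2 := by
  choose B hB using hF
  let M : Matrix (Fin 2) (Fin 2) F := Matrix.of B
  have hM : M.map (algebraMap F ℚ_[p]) = toPadic A := by
    ext i j
    exact hB i j
  refine IsEigenpoint.isIntegral_and_natDegree_minpoly_le_two (M := Mᵀ) ?_ ?_
    (rep_one_ne_zero_of_mem_LMad hx)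
  · refine transpose_ne_smul_one (ne_smul_one_of_map_ne_smul_one (algebraMap F ℚ_[p]) ?_)
    rw [hM, ← pow_one (toPadic A)]
    exact toPadic_pow_ne_smul_one hA one_ne_zero
  · rw [transpose_map, hM]
    exact isEigenpoint_transpose_of_mem_SLtilde hA hV hx

theorem exists_isEigenpoint_transpose_toAlgCl_iff (hA : A ∈ SLtilde p) :
    ∃ w₁ w₂, w₁ ≠ w₂ ∧ ∀ v, IsEigenpoint (toAlgCl p A)ᵀ v ↔ v = w₁ ∨ v = w₂ := by
  obtain ⟨v₁, v₂, hv, h₁, h₂⟩ := hA.1.2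
  refine exists_isEigenpoint_transpose_iff ?_ hv h₁ h₂
  rw [← pow_one (toAlgCl p A)]
  exact toAlgCl_pow_ne_smul_one hA one_ne_zero

end LMad

end PadicLittlewood

theorem theorem6p3 (p : ℕ) [Fact p.Prime] (w : ℕ → ℕ) (A : Matrix (Fin 2) (Fin 2) ℤ_[p])
    (hA : A ∈ SLtilde p) (hV : A ∈ Vp p w) :
    -- `Aᵀ` has exactly two eigenvectors, and they are the only candidates for `x`
    (∃ w₁ w₂ : Projectivization (PadicAlgCl p) (Fin 2 → PadicAlgCl p),
      w₁ ≠ w₂ ∧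
      (∀ v, IsEigenpoint (toAlgCl p A).transpose v ↔ v = w₁ ∨ v = w₂) ∧
      ∀ x : Projectivization ℚ_[p] (Fin 2 → ℚ_[p]), (w, x) ∈ LMad p →
        pointToAlgCl p x = w₁ ∨ pointToAlgCl p x = w₂) ∧
    {x : Projectivization ℚ_[p] (Fin 2 → ℚ_[p]) | (w, x) ∈ LMad p}.encard ≤ 2 ∧
    -- `x = (ξ : 1)` with `ξ` irrational and at most quadratic over the field of the entries of `A`
    ∀ x : Projectivization ℚ_[p] (Fin 2 → ℚ_[p]), (w, x) ∈ LMad p →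
      x.rep 1 ≠ 0 ∧
      (∀ r : ℚ, affineCoord p x ≠ (r : ℚ_[p])) ∧
      IsIntegral (entryField p A) (affineCoord p x) ∧
      (minpoly (entryField p A) (affineCoord p x)).natDegree ≤ 2 ∧
      ((∀ i j, ∃ r : ℚ, (A i j : ℚ_[p]) = (r : ℚ_[p])) →
        IsIntegral ℚ (affineCoord p x) ∧ (minpoly ℚ (affineCoord p x)).natDegree = 2) := by
  obtain ⟨w₁, w₂, hw, h_eigen⟩ := exists_isEigenpoint_transpose_toAlgCl_iff hA
  have h_mem (x) (hx : (w, x) ∈ LMad p) : pointToAlgCl p x = w₁ ∨ pointToAlgCl p x = w₂ :=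
    (h_eigen _).mp (isEigenpoint_pointToAlgCl_iff.mpr
      (isEigenpoint_transpose_of_mem_SLtilde hA hV hx))
  refine ⟨⟨w₁, w₂, hw, h_eigen, h_mem⟩, ?_, fun x hx => ?_⟩
  · rw [← pointToAlgCl_injective.encard_image, ← Set.encard_pair hw]
    exact Set.encard_le_encard (Set.image_subset_iff.mpr h_mem)
  have h_irrational := affineCoord_ne_ratCast_of_mem_LMad hx
  obtain ⟨h_int, h_deg⟩ := isIntegral_and_natDegree_minpoly_affineCoord_le_two
    (F := entryField p A) hA hV hx fun i j =>
      ⟨⟨A i j, IntermediateField.subset_adjoin _ _ ⟨i, j, rfl⟩⟩, rfl⟩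
  refine ⟨rep_one_ne_zero_of_mem_LMad hx, h_irrational, h_int, h_deg, fun h_rat => ?_⟩
  obtain ⟨h_int_rat, h_deg_rat⟩ := isIntegral_and_natDegree_minpoly_affineCoord_le_two
    (F := ℚ) hA hV hx fun i j => (h_rat i j).imp fun r hr => by rw [hr, eq_ratCast]
  refine ⟨h_int_rat, h_deg_rat.antisymm ((minpoly.two_le_natDegree_iff h_int_rat).mpr ?_)⟩
  rintro ⟨r, hr⟩
  exact h_irrational r (by rw [← hr, eq_ratCast])
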